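/- Fix a countable continuous signature $L$: a distinguished metric symbol $d$ together with countably many predicate symbols and function symbols of finite arity (constants being $0$-ary function symbols), each equipped with a continuity modulus $\gamma:(0,\infty)\to(0,\infty)$. A *metric $L$-structure* is a non-empty complete metric space $(M,d)$ with $d\le 1$, together with an operation $F^M:M^k\to M$ for each $k$-ary function symbol $F$ and a map $R^M:M^k\to[0,1]$ for each $k$-ary predicate symbol $R$, respecting the moduli: if two $k$-tuples $\bar x,\bar x'$ differ only in the $j$-th coordinate and $d(x_j,x_j')<\gamma_F(\varepsilon)$ (resp. $<\gamma_R(\varepsilon)$), then $d(F^M(\bar x),F^M(\bar x'))\le\varepsilon$ (resp. $|R^M(\bar x)-R^M(\bar x')|\le\varepsilon$). *Formulas* are built from $0$, $1$ and the atomic formulas $R(t_1,\dots,t_k)$, $d(t_1,t_2)$ ($t_i$ terms) by the connectives $x/2$, $\max(x-y,0)$, $\min(x,y)$, $\max(x,y)$, $|x-y|$, $1-x$, $\min(x+y,1)$ and the quantifiers $\sup_x$, $\inf_x$; they take values in $[0,1]$. A *closed condition* is an expression $\varphi=0$ with $\varphi$ a formula without free variables, and a *theory* is a set of closed conditions. A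 *substructure* of $M$ is a non-empty closed subset that is closed under the operations, with the restricted metric, operations and predicates; it is *elementary* if every formula takes the same value at every tuple of its elements in the substructure and in $M$. A *metric isomorphism* is an isometric bijection that commutes with the operations and preserves the values of the predicates. The *ultraproduct* of a family $(M_i)_{i\in I}$ of metric $L$-structures along an ultrafilter $U$ on $I$ is the quotient of $\prod_{i} M_i$ by the relation $\lim_U d(x_i,y_i)=0$, with metric $\lim_U d(x_i,y_i)$, operations computed coordinatewise, and predicates $\lim_U R^{M_i}$. Let $\mathcal C$ be a class of metric $L$-structures. A theory $T$ *axiomatizes* $\mathcal C$ if $\mathcal C$ is exactly the class of all metric $L$-structures satisfying every condition in $T$, and $\mathcal C$ is *axiomatizable in continuous logic* if some theory axiomatizes it. Let $Th^c_{\sup}(\mathcal C)$ be the set of all closed conditions of the form $\sup_{x_1}\cdots\sup_{x_n}\varphi=0$, with $\varphi$ containing no $\sup$ and no $\inf$, that hold in all structures of $\mathcal C$. **Theorem.** (1) $\mathcal C$ is axiomatizable in continuous logic if and only if it is closed under metric isomorphisms, ultraproducts and elementary substructures. (2) $\mathcal C$ is axiomatized by $Th^c_{\sup}(\mathcal C)$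 if and only if it is closed under metric isomorphisms, ultraproducts and substructures. -/

import Mathlib

open Filter Topology

universe u

namespace ContLogic

/-- A (one-sorted) continuous signature: predicate and function symbols, each with a finite arity
and a continuity modulus.  The metric symbol `d` is always present and is treated as logical.
Constants are function symbols of arity `0`. -/
structure Signature where
  Pred : Type
  predArity : Pred → ℕ
  predMod : Pred → ℝ → ℝ
  predMod_pos : ∀ R ε, 0 < ε → 0 < predMod R ε
  Func : Type
  funcArity : Func → ℕ
  funcMod : Func → ℝ → ℝ
  funcMod_pos : ∀ F ε, 0 < ε → 0 < funcMod F ε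

/-- A metric `L`-structure: a non-empty complete metric space of diameter at most `1` with
operations and `[0,1]`-valued predicates that obey the continuity moduli of the signature
(in each argument). -/
structure MetricStructure (L : Signature) where
  Carrier : Type u
  [metric : MetricSpace Carrier]
  [complete : CompleteSpace Carrier]
  [nonempty : Nonempty Carrier]
  dist_le_one : ∀ x y : Carrier, dist x y ≤ 1
  func : ∀ F : L.Func, (Fin (L.funcArity F) → Carrier) → Carrier
  func_mod : ∀ (F : L.Func) (x : Fin (L.funcArity F) → Carrier) (j : Fin (L.funcArity F))
    (b : Carrier) (ε : ℝ), 0 < ε → dist (x j) b < L.funcMod F ε →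
    dist (func F x) (func F (Function.update x j b)) ≤ ε
  pred : ∀ R : L.Pred, (Fin (L.predArity R) → Carrier) → ℝ
  pred_mem : ∀ R x, pred R x ∈ Set.Icc (0 : ℝ) 1
  pred_mod : ∀ (R : L.Pred) (x : Fin (L.predArity R) → Carrier) (j : Fin (L.predArity R))
    (b : Carrier) (ε : ℝ), 0 < ε → dist (x j) b < L.predMod R ε →
    |pred R x - pred R (Function.update x j b)| ≤ ε

attribute [instance] MetricStructure.metric MetricStructure.complete MetricStructure.nonempty

instance (L : Signature) : CoeSort (MetricStructure.{u} L) (Type u) :=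
  ⟨MetricStructure.Carrier⟩

section Formulas

/-- Terms in the variables `x_0, …, x_{n-1}`. -/
inductive Term (L : Signature) (n : ℕ) : Type
  | var : Fin n → Term L n
  | app : (F : L.Func) → (Fin (L.funcArity F) → Term L n) → Term L n

/-- Formulas with free variables among `x_0, …, x_{n-1}`.  The quantifiers `sup` and `inf` bind
the variable `x_0` of their argument; the variable `x_{k+1}` of the argument becomes `x_k`. -/
inductive Formula (L : Signature) : ℕ → Type
  | zero {n : ℕ} : Formula L n
  | one {n : ℕ} : Formula L n
  | pred {n : ℕ} (R : L.Pred) (t : Fin (L.predArity R) → Term L n) : Formula L n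
  | dist {n : ℕ} (t₁ t₂ : Term L n) : Formula L n
  | half {n : ℕ} (φ : Formula L n) : Formula L n
  | dotMinus {n : ℕ} (φ ψ : Formula L n) : Formula L n
  | min {n : ℕ} (φ ψ : Formula L n) : Formula L n
  | max {n : ℕ} (φ ψ : Formula L n) : Formula L n
  | absDiff {n : ℕ} (φ ψ : Formula L n) : Formula L n
  | neg {n : ℕ} (φ : Formula L n) : Formula L n
  | dotPlus {n : ℕ} (φ ψ : Formula L n) : Formula L n
  | sup {n : ℕ} (φ : Formula L (n + 1)) : Formula L n
  | inf {n : ℕ} (φ : Formula L (n + 1)) : Formula L n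

/-- Closed formulas; the sentence `φ` stands for the closed condition `φ = 0`. -/
abbrev Sentence (L : Signature) : Type := Formula L 0

variable {L : Signature}

/-- The formula contains neither `sup` nor `inf`. -/
def Formula.QuantifierFree : {n : ℕ} → Formula L n → Prop
  | _, .zero => True
  | _, .one => True
  | _, .pred _ _ => True
  | _, .dist _ _ => True
  | _, .half φ => φ.QuantifierFree
  | _, .dotMinus φ ψ => φ.QuantifierFree ∧ ψ.QuantifierFree
  | _, .min φ ψ => φ.QuantifierFree ∧ ψ.QuantifierFree
  | _, .max φ ψ => φ.QuantifierFree ∧ ψ.QuantifierFree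
  | _, .absDiff φ ψ => φ.QuantifierFree ∧ ψ.QuantifierFree
  | _, .neg φ => φ.QuantifierFree
  | _, .dotPlus φ ψ => φ.QuantifierFree ∧ ψ.QuantifierFree
  | _, .sup _ => False
  | _, .inf _ => False

/-- `sup … sup φ`, binding all the `n` variables of `φ`. -/
def Formula.supClosure : {n : ℕ} → Formula L n → Sentence L
  | 0, φ => φ
  | _ + 1, φ => Formula.supClosure (.sup φ)

/-- The value of a term in `M` at the tuple `v`. -/
def Term.eval (M : MetricStructure.{u} L) {n : ℕ} (v : Fin n → M) : Term L n → M
  | .var i => v i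
  | .app F t => M.func F (fun j => (t j).eval M v)

/-- The value of a formula in `M` at the tuple `v`; it lies in `[0,1]`, see
`Formula.eval_mem_Icc`. -/
noncomputable def Formula.eval (M : MetricStructure.{u} L) :
    {n : ℕ} → Formula L n → (Fin n → M) → ℝ
  | _, .zero, _ => 0
  | _, .one, _ => 1
  | _, .pred R t, v => M.pred R (fun j => (t j).eval M v)
  | _, .dist t₁ t₂, v => Dist.dist (t₁.eval M v) (t₂.eval M v)
  | _, .half φ, v => φ.eval M v / 2
  | _, .dotMinus φ ψ, v => Max.max (φ.eval M v - ψ.eval M v) 0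
  | _, .min φ ψ, v => Min.min (φ.eval M v) (ψ.eval M v)
  | _, .max φ ψ, v => Max.max (φ.eval M v) (ψ.eval M v)
  | _, .absDiff φ ψ, v => |φ.eval M v - ψ.eval M v|
  | _, .neg φ, v => 1 - φ.eval M v
  | _, .dotPlus φ ψ, v => Min.min (φ.eval M v + ψ.eval M v) 1
  | _, .sup φ, v => ⨆ a : M, φ.eval M (Fin.cons a v)
  | _, .inf φ, v => ⨅ a : M, φ.eval M (Fin.cons a v)

theorem Formula.eval_mem_Icc (M : MetricStructure.{u} L) {n : ℕ} (φ : Formula L n)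
    (v : Fin n → M) : φ.eval M v ∈ Set.Icc (0 : ℝ) 1 := by
  induction φ with
  | zero => simp [Formula.eval]
  | one => simp [Formula.eval]
  | pred R t => exact M.pred_mem _ _
  | dist t₁ t₂ => exact ⟨dist_nonneg, M.dist_le_one _ _⟩
  | half φ h =>
    obtain ⟨h0, h1⟩ := h v
    simp only [Formula.eval, Set.mem_Icc]; constructor <;> linarith
  | dotMinus φ ψ h h' =>
    obtain ⟨h0, h1⟩ := h v
    obtain ⟨h0', h1'⟩ := h' v
    exact ⟨le_max_right _ _, max_le (by linarith) zero_le_one⟩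
  | min φ ψ h h' =>
    exact ⟨le_min (h v).1 (h' v).1, (min_le_left _ _).trans (h v).2⟩
  | max φ ψ h h' =>
    exact ⟨(h v).1.trans (le_max_left _ _), max_le (h v).2 (h' v).2⟩
  | absDiff φ ψ h h' =>
    obtain ⟨h0, h1⟩ := h v
    obtain ⟨h0', h1'⟩ := h' v
    exact ⟨abs_nonneg _, abs_le.2 ⟨by linarith, by linarith⟩⟩
  | neg φ h =>
    obtain ⟨h0, h1⟩ := h v
    simp only [Formula.eval, Set.mem_Icc]; constructor <;> linarith
  | dotPlus φ ψ h h' =>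
    exact ⟨le_min (add_nonneg (h v).1 (h' v).1) zero_le_one, min_le_right _ _⟩
  | sup φ h =>
    exact ⟨Real.iSup_nonneg fun a => (h _).1, ciSup_le fun a => (h _).2⟩
  | inf φ h =>
    refine ⟨Real.iInf_nonneg fun a => (h _).1, ?_⟩
    obtain ⟨a⟩ := M.nonempty
    exact (ciInf_le ⟨0, by rintro _ ⟨b, rfl⟩; exact (h _).1⟩ a).trans (h _).2

end Formulas

section Classes

variable {L : Signature}

/-- `M` satisfies the closed condition `φ = 0`. -/
def Satisfies (M : MetricStructure.{u} L) (φ : Sentence L) : Prop :=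
  φ.eval M Fin.elim0 = 0

/-- `M` is a model of the theory `T` (a set of closed conditions). -/
def Models (M : MetricStructure.{u} L) (T : Set (Sentence L)) : Prop :=
  ∀ φ ∈ T, Satisfies M φ

/-- The theory `T` axiomatizes the class `C`. -/
def AxiomatizedBy (C : Set (MetricStructure.{u} L)) (T : Set (Sentence L)) : Prop :=
  ∀ M : MetricStructure.{u} L, M ∈ C ↔ Models M T

/-- The class `C` is axiomatizable in continuous logic. -/
def Axiomatizable (C : Set (MetricStructure.{u} L)) : Prop :=
  ∃ T : Set (Sentence L), AxiomatizedBy C T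

/-- All conditions `sup … sup φ = 0`, with `φ` free of quantifiers, that hold in every member
of `C`. -/
def supTheory (C : Set (MetricStructure.{u} L)) : Set (Sentence L) :=
  {σ | (∃ (n : ℕ) (φ : Formula L n), φ.QuantifierFree ∧ σ = φ.supClosure) ∧
    ∀ M ∈ C, Satisfies M σ}

/-- Metric isomorphisms: isometric bijections that respect all operations and predicates. -/
structure Iso (M N : MetricStructure.{u} L) where
  toEquiv : M ≃ N
  dist_eq : ∀ x y, dist (toEquiv x) (toEquiv y) = dist x y
  map_func : ∀ F x, toEquiv (M.func F x) = N.func F (fun j => toEquiv (x j))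
  map_pred : ∀ R x, N.pred R (fun j => toEquiv (x j)) = M.pred R x

/-- (The universes of) substructures of `M`: non-empty closed subsets that are closed under the
operations. -/
structure Substructure (M : MetricStructure.{u} L) where
  carrier : Set M
  nonempty' : carrier.Nonempty
  isClosed' : IsClosed carrier
  func_mem : ∀ (F : L.Func) (x : Fin (L.funcArity F) → M), (∀ j, x j ∈ carrier) →
    M.func F x ∈ carrier

/-- A substructure as a metric structure, with everything restricted from `M`. -/
def Substructure.toStructure {M : MetricStructure.{u} L} (S : Substructure M) :
    MetricStructure.{u} L :=
  letI : CompleteSpace S.carrier := S.isClosed'.completeSpace_coe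
  letI : Nonempty S.carrier := S.nonempty'.to_subtype
  { Carrier := S.carrier
    dist_le_one := fun x y => M.dist_le_one x y
    func := fun F x => ⟨M.func F (fun j => (x j : M)), S.func_mem F _ fun j => (x j).2⟩
    func_mod := by
      intro F x j b ε hε h
      have e : (fun k => ((Function.update x j b k : S.carrier) : M)) =
          Function.update (fun k => (x k : M)) j b := by
        funext k
        by_cases hk : k = j
        · subst hk; simp
        · simp [hk]
      simpa only [Subtype.dist_eq, e] using M.func_mod F (fun k => (x k : M)) j b ε hε h
    pred := fun R x => M.pred R (fun j => (x j : M))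
    pred_mem := fun R x => M.pred_mem R _
    pred_mod := by
      intro R x j b ε hε h
      have e : (fun k => ((Function.update x j b k : S.carrier) : M)) =
          Function.update (fun k => (x k : M)) j b := by
        funext k
        by_cases hk : k = j
        · subst hk; simp
        · simp [hk]
      simpa only [e] using M.pred_mod R (fun k => (x k : M)) j b ε hε h }

/-- The inclusion of a substructure. -/
def Substructure.incl {M : MetricStructure.{u} L} (S : Substructure M) :
    S.toStructure → M :=
  fun x => (show S.carrier from x).1

/-- `S` is an elementary substructure: all formulas take the same values in `S` and in `M`. -/
def Substructure.IsElementary {M : MetricStructure.{u} L} (S : Substructure M) : Prop :=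
  ∀ (n : ℕ) (φ : Formula L n) (a : Fin n → S.toStructure),
    φ.eval S.toStructure a = φ.eval M (fun i => S.incl (a i))

end Classes

section Ultraproducts

variable {L : Signature} {I : Type u}

/-- The limit of a real function along an ultrafilter (used for functions with values
in `[0,1]`, where it exists). -/
noncomputable def ulim (U : Ultrafilter I) (f : I → ℝ) : ℝ := limUnder (U : Filter I) f

theorem tendsto_ulim (U : Ultrafilter I) {f : I → ℝ} (hf : ∀ i, f i ∈ Set.Icc (0 : ℝ) 1) :
    Tendsto f U (𝓝 (ulim U f)) := by
  have h : ((U.map f : Ultrafilter ℝ) : Filter ℝ) ≤ 𝓟 (Set.Icc (0 : ℝ) 1) := by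
    rw [Filter.le_principal_iff]
    exact Filter.mem_map.2 (Filter.univ_mem' hf)
  obtain ⟨x, -, hx⟩ := isCompact_Icc.ultrafilter_le_nhds (U.map f) h
  exact tendsto_nhds_limUnder ⟨x, hx⟩

theorem MetricStructure.dist_mem (M : MetricStructure.{u} L) (x y : M) :
    dist x y ∈ Set.Icc (0 : ℝ) 1 := ⟨dist_nonneg, M.dist_le_one x y⟩

/-- The full product of a family of structures, to be equipped with the pseudometric
`lim_U d(x_i, y_i)`. -/
structure PreUltra (U : Ultrafilter I) (M : I → MetricStructure.{u} L) : Type u where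
  of ::
  val : ∀ i, M i

variable (U : Ultrafilter I) (M : I → MetricStructure.{u} L)

noncomputable instance PreUltra.pseudoMetric : PseudoMetricSpace (PreUltra U M) where
  dist x y := ulim U fun i => dist (x.val i) (y.val i)
  dist_self x := by
    have h := tendsto_ulim U (fun i => (M i).dist_mem (x.val i) (x.val i))
    refine tendsto_nhds_unique h ?_
    simp
  dist_comm x y := by simp only [dist_comm]
  dist_triangle x y z :=
    le_of_tendsto_of_tendsto' (tendsto_ulim U (fun i => (M i).dist_mem (x.val i) (z.val i)))
      ((tendsto_ulim U (fun i => (M i).dist_mem (x.val i) (y.val i))).add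
        (tendsto_ulim U (fun i => (M i).dist_mem (y.val i) (z.val i))))
      (fun i => dist_triangle _ _ _)

variable {U M}

theorem PreUltra.dist_def (x y : PreUltra U M) :
    dist x y = ulim U fun i => dist (x.val i) (y.val i) := rfl

theorem PreUltra.tendsto_dist (x y : PreUltra U M) :
    Tendsto (fun i => dist (x.val i) (y.val i)) U (𝓝 (dist x y)) :=
  tendsto_ulim U (fun i => (M i).dist_mem (x.val i) (y.val i))

instance PreUltra.completeSpace : CompleteSpace (PreUltra U M) := by
  refine Metric.complete_of_convergent_controlled_sequences (fun n => 1 / 2 / 2 ^ n)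
    (fun n => by positivity) ?_
  intro s hs
  let P : I → ℕ → Prop := fun i n => ∀ k < n, dist ((s k).val i) ((s (k + 1)).val i) < 1 / 2 / 2 ^ k
  classical
  let w : ∀ i, ℕ → M i := fun i k =>
    Nat.rec (motive := fun _ => M i) ((s 0).val i) (fun k r => if P i (k + 1) then (s (k + 1)).val i else r) k
  have hwP : ∀ i n, P i n → w i n = (s n).val i := by
    intro i n h
    cases n with
    | zero => rfl
    | succ n => exact if_pos h
  have hw : ∀ i k, dist (w i k) (w i (k + 1)) ≤ 1 / 2 / 2 ^ k := by
    intro i k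
    by_cases h : P i (k + 1)
    · rw [hwP i k (fun j hj => h j (by omega)), hwP i (k + 1) h]
      exact (h k (by omega)).le
    · have : w i (k + 1) = w i k := if_neg h
      rw [this, dist_self]; positivity
  have hlim : ∀ i, ∃ a, Tendsto (w i) atTop (𝓝 a) := fun i =>
    cauchySeq_tendsto_of_complete (cauchySeq_of_le_geometric_two (hw i))
  choose y hy using hlim
  have hd : ∀ i n, dist (w i n) (y i) ≤ 1 / 2 ^ n := fun i n =>
    dist_le_of_le_geometric_two_of_tendsto (hw i) (hy i) n
  have hPU : ∀ n, ∀ᶠ i in (U : Filter I), P i n := by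
    intro n
    have : ∀ᶠ i in (U : Filter I), ∀ k ∈ Set.Iio n,
        dist ((s k).val i) ((s (k + 1)).val i) < 1 / 2 / 2 ^ k := by
      rw [Filter.eventually_all_finite (Set.finite_Iio n)]
      intro k _
      exact (PreUltra.tendsto_dist (s k) (s (k + 1))).eventually_lt_const
        (hs k k (k + 1) le_rfl (Nat.le_succ k))
    exact this
  refine ⟨PreUltra.of y, ?_⟩
  rw [tendsto_iff_dist_tendsto_zero]
  refine squeeze_zero (fun _ => dist_nonneg) (g := fun n => (1 / 2 : ℝ) ^ n) (fun n => ?_)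
    (tendsto_pow_atTop_nhds_zero_of_lt_one (by norm_num) (by norm_num))
  refine le_of_tendsto (PreUltra.tendsto_dist (s n) (PreUltra.of y)) ?_
  filter_upwards [hPU n] with i hi
  have := hd i n
  rw [hwP i n hi] at this
  simpa using this

/-- A representative of a point of the quotient. -/
noncomputable def PreUltra.rep (x : SeparationQuotient (PreUltra U M)) : PreUltra U M :=
  Function.surjInv SeparationQuotient.surjective_mk x

theorem PreUltra.mk_rep (x : SeparationQuotient (PreUltra U M)) :
    SeparationQuotient.mk (PreUltra.rep x) = x :=
  Function.surjInv_eq SeparationQuotient.surjective_mk x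

theorem PreUltra.dist_rep (x y : SeparationQuotient (PreUltra U M)) :
    dist (PreUltra.rep x) (PreUltra.rep y) = dist x y := by
  rw [← SeparationQuotient.dist_mk, PreUltra.mk_rep, PreUltra.mk_rep]

theorem PreUltra.rep_update {n : ℕ} (x : Fin n → SeparationQuotient (PreUltra U M)) (j : Fin n)
    (b : SeparationQuotient (PreUltra U M)) (i : I) :
    (fun k => (PreUltra.rep (Function.update x j b k)).val i) =
      Function.update (fun k => (PreUltra.rep (x k)).val i) j ((PreUltra.rep b).val i) := by
  funext k
  by_cases hk : k = j
  · subst hk; simp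
  · simp [hk]

variable (U M)

/-- The metric ultraproduct of the structures `M i` along `U`: the quotient of the product by
`lim_U d(x_i, y_i) = 0`, with operations computed coordinatewise and predicates computed as
limits along `U`.  The values do not depend on the representatives, see `ultraproduct_func_mk`
and `ultraproduct_pred_mk`. -/
noncomputable def ultraproduct : MetricStructure.{u} L :=
  letI : Nonempty (PreUltra U M) := ⟨.of fun i => Classical.choice (M i).nonempty⟩
  { Carrier := SeparationQuotient (PreUltra U M)
    dist_le_one := by
      intro x y
      rw [← PreUltra.dist_rep]
      exact le_of_tendsto' (PreUltra.tendsto_dist _ _) (fun i => (M i).dist_le_one _ _)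
    func := fun F x => SeparationQuotient.mk
      (PreUltra.of fun i => (M i).func F (fun j => (PreUltra.rep (x j)).val i))
    func_mod := by
      intro F x j b ε hε h
      rw [SeparationQuotient.dist_mk]
      refine le_of_tendsto (PreUltra.tendsto_dist _ _) ?_
      rw [← PreUltra.dist_rep] at h
      filter_upwards [(PreUltra.tendsto_dist _ _).eventually_lt_const h] with i hi
      rw [PreUltra.rep_update]
      exact (M i).func_mod F _ j _ ε hε hi
    pred := fun R x => ulim U fun i => (M i).pred R (fun j => (PreUltra.rep (x j)).val i)
    pred_mem := fun R x => isClosed_Icc.mem_of_tendsto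
      (tendsto_ulim U fun i => (M i).pred_mem R _) (Eventually.of_forall fun i => (M i).pred_mem R _)
    pred_mod := by
      intro R x j b ε hε h
      refine le_of_tendsto ((tendsto_ulim U fun i => (M i).pred_mem R _).sub
        (tendsto_ulim U fun i => (M i).pred_mem R _)).abs ?_
      rw [← PreUltra.dist_rep] at h
      filter_upwards [(PreUltra.tendsto_dist _ _).eventually_lt_const h] with i hi
      rw [PreUltra.rep_update]
      exact (M i).pred_mod R _ j _ ε hε hi }

variable {U M}

/-- The class in the ultraproduct of a point of the product. -/
noncomputable def ultraMk (x : ∀ i, M i) : ultraproduct U M :=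
  (SeparationQuotient.mk (PreUltra.of x) : SeparationQuotient (PreUltra U M))

theorem surjective_ultraMk :
    Function.Surjective (ultraMk : (∀ i, M i) → ultraproduct U M) :=
  fun x => ⟨(PreUltra.rep x).val, PreUltra.mk_rep x⟩

theorem ultraproduct_dist_mk (x y : ∀ i, M i) :
    dist (ultraMk x : ultraproduct U M) (ultraMk y) = ulim U fun i => dist (x i) (y i) := rfl

/-- Continuity in each argument gives joint continuity. -/
theorem joint_le {X Y : Type*} [PseudoMetricSpace X] [PseudoMetricSpace Y] {n : ℕ}
    (f : (Fin n → X) → Y) (δ ε : ℝ)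
    (hf : ∀ x j b, dist (x j) b < δ → dist (f x) (f (Function.update x j b)) ≤ ε)
    (x y : Fin n → X) (h : ∀ j, dist (x j) (y j) < δ) : dist (f x) (f y) ≤ n * ε := by
  classical
  have key : ∀ s : Finset (Fin n), dist (f x) (f (s.piecewise y x)) ≤ s.card * ε := by
    intro s
    induction s using Finset.induction_on with
    | empty => simp
    | insert a s ha ih =>
      rw [Finset.piecewise_insert, Finset.card_insert_of_notMem ha]
      have h1 := hf (s.piecewise y x) a (y a) (by simpa [ha] using h a)
      have h2 := dist_triangle (f x) (f (s.piecewise y x))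
        (f (Function.update (s.piecewise y x) a (y a)))
      push_cast
      linarith
  simpa using key Finset.univ

theorem rep_dist_eventually {n : ℕ} (x : Fin n → ∀ i, M i) {δ : ℝ} (hδ : 0 < δ) :
    ∀ᶠ i in (U : Filter I), ∀ j, dist ((PreUltra.rep
      (SeparationQuotient.mk (PreUltra.of (U := U) (x j)))).val i) (x j i) < δ := by
  rw [Filter.eventually_all]
  intro j
  refine (PreUltra.tendsto_dist _ (PreUltra.of (U := U) (x j))).eventually_lt_const ?_
  rw [← SeparationQuotient.dist_mk, PreUltra.mk_rep, dist_self]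
  exact hδ

theorem ultraproduct_func_mk (F : L.Func) (x : Fin (L.funcArity F) → ∀ i, M i) :
    (ultraproduct U M).func F (fun j => ultraMk (x j)) =
      ultraMk (fun i => (M i).func F (fun j => x j i)) := by
  refine dist_le_zero.1 (le_of_forall_pos_le_add fun ε hε => ?_)
  have hn : (0 : ℝ) < L.funcArity F + 1 := by positivity
  refine le_of_tendsto (PreUltra.tendsto_dist (U := U) (M := M) _ _) ?_
  filter_upwards [rep_dist_eventually (U := U) x
    (L.funcMod_pos F _ (div_pos hε hn))] with i hi
  have h1 := joint_le ((M i).func F) _ (ε / (L.funcArity F + 1))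
    (fun x j b hb => (M i).func_mod F x j b _ (div_pos hε hn) hb) _ _ hi
  refine h1.trans ?_
  rw [zero_add, mul_div_assoc', div_le_iff₀ hn]
  nlinarith

theorem ultraproduct_pred_mk (R : L.Pred) (x : Fin (L.predArity R) → ∀ i, M i) :
    (ultraproduct U M).pred R (fun j => ultraMk (x j)) =
      ulim U fun i => (M i).pred R (fun j => x j i) := by
  refine dist_le_zero.1 (le_of_forall_pos_le_add fun ε hε => ?_)
  have hn : (0 : ℝ) < L.predArity R + 1 := by positivity
  refine le_of_tendsto ((tendsto_ulim U fun i => (M i).pred_mem R _).dist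
    (tendsto_ulim U fun i => (M i).pred_mem R _)) ?_
  filter_upwards [rep_dist_eventually (U := U) x
    (L.predMod_pos R _ (div_pos hε hn))] with i hi
  have h1 := joint_le ((M i).pred R) _ (ε / (L.predArity R + 1))
    (fun x j b hb => (M i).pred_mod R x j b _ (div_pos hε hn) hb) _ _ hi
  refine h1.trans ?_
  rw [zero_add, mul_div_assoc', div_le_iff₀ hn]
  nlinarith

end Ultraproducts

section Closure

variable {L : Signature}

def ClosedUnderIso (C : Set (MetricStructure.{u} L)) : Prop :=
  ∀ M N : MetricStructure.{u} L, M ∈ C → Nonempty (Iso M N) → N ∈ C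

def ClosedUnderUltraproducts (C : Set (MetricStructure.{u} L)) : Prop :=
  ∀ (I : Type u) (U : Ultrafilter I) (M : I → MetricStructure.{u} L),
    (∀ i, M i ∈ C) → ultraproduct U M ∈ C

def ClosedUnderSubstructures (C : Set (MetricStructure.{u} L)) : Prop :=
  ∀ M ∈ C, ∀ S : Substructure M, S.toStructure ∈ C

def ClosedUnderElementarySubstructures (C : Set (MetricStructure.{u} L)) : Prop :=
  ∀ M ∈ C, ∀ S : Substructure M, S.IsElementary → S.toStructure ∈ C

end Closure

end ContLogic

/-!
The substance is that the closure conditions suffice; that they are necessary is Łoś's theorem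
(`tendsto_eval_ultraproduct`) together with the invariance of values under isomorphisms and of
quantifier-free values under substructures.

For sufficiency both parts are proved at once, for a *fragment* `P` of formulas: all formulas in
part (1), the quantifier-free ones in part (2).  Let `M` satisfy every condition
`sup … sup φ = 0` with `φ` in `P` that holds throughout `C`.  If `φ(a) = 0` in `M` and `ε > 0`,
then some structure in `C` has a tuple `b` with `φ(b) < ε`: otherwise `2⁻ᵏ ∸ φ` vanishes
identically on `C` for some `k`, hence on `M`, although its value at `a` is `2⁻ᵏ`
(`Fragment.exists_eval_lt`).  Renaming variables and taking maxima gives the same for finitely many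
conditions with parameters (`Fragment.exists_finset_eval_lt`).  So the `P`-diagram of `M` is
approximately finitely satisfiable in `C`, and an ultraproduct of structures in `C`, indexed by the
finite sets of conditions and the tolerances, satisfies it exactly
(`Fragment.exists_ultraproduct_map`).  The resulting map from `M` preserves the values of the
formulas in `P`; it is therefore an isometric embedding whose image is a substructure isomorphic to
`M`, and an elementary one if `P` consists of all formulas.  Since the parameters of `M` are part of
the diagram, no theorem of Keisler–Shelah type on ultraroots is needed.
-/

namespace ContLogic

variable {L : Signature}

/-! ### Renaming of variables -/

/-- Substitution of the variable `x_{f i}` for `x_i` in a term. -/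
def Term.rename {n m : ℕ} (f : Fin n → Fin m) : Term L n → Term L m
  | .var i => .var (f i)
  | .app F t => .app F fun j => (t j).rename f

/-- The renaming `f` extended to the scope of a quantifier: the bound variable `x_0` is fixed. -/
def liftRenaming {n m : ℕ} (f : Fin n → Fin m) : Fin (n + 1) → Fin (m + 1) :=
  Fin.cons 0 fun i => (f i).succ

/-- Substitution of the variable `x_{f i}` for the free variable `x_i` in a formula. -/
def Formula.rename : {n m : ℕ} → (Fin n → Fin m) → Formula L n → Formula L m
  | _, _, _, .zero => .zero
  | _, _, _, .one => .one
  | _, _, f, .pred R t => .pred R fun j => (t j).rename f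
  | _, _, f, .dist t₁ t₂ => .dist (t₁.rename f) (t₂.rename f)
  | _, _, f, .half φ => .half (φ.rename f)
  | _, _, f, .dotMinus φ ψ => .dotMinus (φ.rename f) (ψ.rename f)
  | _, _, f, .min φ ψ => .min (φ.rename f) (ψ.rename f)
  | _, _, f, .max φ ψ => .max (φ.rename f) (ψ.rename f)
  | _, _, f, .absDiff φ ψ => .absDiff (φ.rename f) (ψ.rename f)
  | _, _, f, .neg φ => .neg (φ.rename f)
  | _, _, f, .dotPlus φ ψ => .dotPlus (φ.rename f) (ψ.rename f)
  | _, _, f, .sup φ => .sup (φ.rename (liftRenaming f))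
  | _, _, f, .inf φ => .inf (φ.rename (liftRenaming f))

theorem Term.eval_rename (M : MetricStructure.{u} L) {n m : ℕ} (f : Fin n → Fin m) (t : Term L n)
    (v : Fin m → M) : (t.rename f).eval M v = t.eval M (v ∘ f) := by
  induction t with
  | var i => rfl
  | app F t ih => simp only [Term.rename, Term.eval, ih]

theorem cons_comp_liftRenaming {X : Type*} {n m : ℕ} (f : Fin n → Fin m) (a : X) (v : Fin m → X) :
    (Fin.cons a v : Fin (m + 1) → X) ∘ liftRenaming f = Fin.cons a (v ∘ f) := by
  funext i
  cases i using Fin.cases <;> simp [liftRenaming]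

theorem Formula.eval_rename (M : MetricStructure.{u} L) {n m : ℕ} (f : Fin n → Fin m)
    (φ : Formula L n) (v : Fin m → M) : (φ.rename f).eval M v = φ.eval M (v ∘ f) := by
  induction φ generalizing m <;>
    simp_all only [Formula.rename, Formula.eval, Term.eval_rename, cons_comp_liftRenaming]

theorem Formula.QuantifierFree.rename {n m : ℕ} (f : Fin n → Fin m) {φ : Formula L n}
    (h : φ.QuantifierFree) : (φ.rename f).QuantifierFree := by
  induction φ generalizing m <;> simp_all [Formula.rename, Formula.QuantifierFree]

/-! ### Universal closures -/

theorem Formula.eval_le_eval_sup (M : MetricStructure.{u} L) {n : ℕ} (φ : Formula L (n + 1))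
    (a : M) (v : Fin n → M) : φ.eval M (Fin.cons a v) ≤ φ.sup.eval M v :=
  le_ciSup (f := fun a => φ.eval M (Fin.cons a v))
    ⟨1, by rintro _ ⟨b, rfl⟩; exact (φ.eval_mem_Icc M _).2⟩ a

theorem Formula.eval_inf_le_eval (M : MetricStructure.{u} L) {n : ℕ} (φ : Formula L (n + 1))
    (a : M) (v : Fin n → M) : φ.inf.eval M v ≤ φ.eval M (Fin.cons a v) :=
  ciInf_le (f := fun a => φ.eval M (Fin.cons a v))
    ⟨0, by rintro _ ⟨b, rfl⟩; exact (φ.eval_mem_Icc M _).1⟩ a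

theorem Formula.eval_sup_eq_zero_iff (M : MetricStructure.{u} L) {n : ℕ} (φ : Formula L (n + 1))
    (v : Fin n → M) : φ.sup.eval M v = 0 ↔ ∀ a : M, φ.eval M (Fin.cons a v) = 0 := by
  constructor
  · intro h a
    exact le_antisymm (h ▸ φ.eval_le_eval_sup M a v) (φ.eval_mem_Icc M _).1
  · intro h
    simp [Formula.eval, h]

/-- Since values are non-negative, a universal closure vanishes exactly if the formula vanishes
identically. -/
theorem satisfies_supClosure_iff (M : MetricStructure.{u} L) {n : ℕ} (φ : Formula L n) :
    Satisfies M φ.supClosure ↔ ∀ v : Fin n → M, φ.eval M v = 0 := by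
  induction n with
  | zero =>
    refine ⟨fun h v => ?_, fun h => h _⟩
    rw [Subsingleton.elim v Fin.elim0]
    exact h
  | succ n ih =>
    refine (ih φ.sup).trans ⟨fun h v => ?_, fun h v => ?_⟩
    · rw [← Fin.cons_self_tail v]
      exact (φ.eval_sup_eq_zero_iff M _).1 (h _) _
    · exact (φ.eval_sup_eq_zero_iff M _).2 fun a => h _

/-! ### Isomorphisms and substructures -/

theorem Iso.term_eval {M N : MetricStructure.{u} L} (e : Iso M N) {n : ℕ} (t : Term L n)
    (v : Fin n → M) : t.eval N (fun i => e.toEquiv (v i)) = e.toEquiv (t.eval M v) := by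
  induction t with
  | var i => rfl
  | app F t ih => simp only [Term.eval, ih, e.map_func]

theorem Iso.cons_eq {M N : MetricStructure.{u} L} (e : Iso M N) {n : ℕ} (a : M) (v : Fin n → M) :
    (Fin.cons (e.toEquiv a) (fun i => e.toEquiv (v i)) : Fin (n + 1) → N) =
      fun i => e.toEquiv ((Fin.cons a v : Fin (n + 1) → M) i) := by
  funext i
  cases i using Fin.cases <;> rfl

theorem Iso.eval {M N : MetricStructure.{u} L} (e : Iso M N) {n : ℕ} (φ : Formula L n)
    (v : Fin n → M) : φ.eval N (fun i => e.toEquiv (v i)) = φ.eval M v := by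
  induction φ with
  | pred R t => simp only [Formula.eval, e.term_eval, e.map_pred]
  | dist t₁ t₂ => simp only [Formula.eval, e.term_eval, e.dist_eq]
  | sup φ ih =>
    simp only [Formula.eval]
    rw [← e.toEquiv.surjective.iSup_comp]
    simp only [e.cons_eq, ih]
  | inf φ ih =>
    simp only [Formula.eval]
    rw [← e.toEquiv.surjective.iInf_comp]
    simp only [e.cons_eq, ih]
  | _ => simp_all only [Formula.eval]

theorem Substructure.term_eval {M : MetricStructure.{u} L} (S : Substructure M) {n : ℕ}
    (t : Term L n) (v : Fin n → S.toStructure) :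
    S.incl (t.eval S.toStructure v) = t.eval M (fun i => S.incl (v i)) := by
  induction t with
  | var i => rfl
  | app F t ih => simp only [Term.eval, ← ih]; rfl

theorem Substructure.eval_of_quantifierFree {M : MetricStructure.{u} L} (S : Substructure M)
    {n : ℕ} {φ : Formula L n} (h : φ.QuantifierFree) (v : Fin n → S.toStructure) :
    φ.eval S.toStructure v = φ.eval M (fun i => S.incl (v i)) := by
  induction φ with
  | pred R t => simp only [Formula.eval, ← S.term_eval]; rfl
  | dist t₁ t₂ => simp only [Formula.eval, ← S.term_eval]; rfl
  | _ => simp_all [Formula.eval, Formula.QuantifierFree]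

/-! ### The theorem of Łoś -/

section Ultraproducts

variable {I : Type u} {U : Ultrafilter I} {N : I → MetricStructure.{u} L}

theorem term_eval_ultraproduct {n : ℕ} (t : Term L n) (x : Fin n → ∀ i, N i) :
    t.eval (ultraproduct U N) (fun j => ultraMk (x j)) =
      ultraMk fun i => t.eval (N i) (fun j => x j i) := by
  induction t with
  | var i => rfl
  | app F t ih => simp only [Term.eval, ih, ultraproduct_func_mk]

theorem cons_ultraMk {n : ℕ} (y : ∀ i, N i) (x : Fin n → ∀ i, N i) :
    (Fin.cons (ultraMk y) (fun j => ultraMk (x j)) : Fin (n + 1) → ultraproduct U N) =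
      fun j => ultraMk ((Fin.cons y x : Fin (n + 1) → ∀ i, N i) j) := by
  funext j
  cases j using Fin.cases <;> rfl

theorem cons_apply_eq {n : ℕ} (y : ∀ i, N i) (x : Fin n → ∀ i, N i) (i : I) :
    (fun j => (Fin.cons y x : Fin (n + 1) → ∀ i, N i) j i) = Fin.cons (y i) (fun j => x j i) := by
  funext j
  cases j using Fin.cases <;> rfl

/-- Łoś's theorem: the value of a formula in an ultraproduct is the limit of its values in the
factors. -/
theorem tendsto_eval_ultraproduct {n : ℕ} (φ : Formula L n) (x : Fin n → ∀ i, N i) :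
    Tendsto (fun i => φ.eval (N i) (fun j => x j i)) U
      (𝓝 (φ.eval (ultraproduct U N) (fun j => ultraMk (x j)))) := by
  induction φ with
  | zero => exact tendsto_const_nhds
  | one => exact tendsto_const_nhds
  | pred R t =>
    simp only [Formula.eval, term_eval_ultraproduct, ultraproduct_pred_mk]
    exact tendsto_ulim U fun i => (N i).pred_mem R _
  | dist t₁ t₂ =>
    simp only [Formula.eval, term_eval_ultraproduct]
    exact PreUltra.tendsto_dist (U := U) (.of _) (.of _)
  | half φ ih => exact (ih x).div_const 2
  | dotMinus φ ψ ih ih' => exact ((ih x).sub (ih' x)).max tendsto_const_nhds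
  | min φ ψ ih ih' => exact (ih x).min (ih' x)
  | max φ ψ ih ih' => exact (ih x).max (ih' x)
  | absDiff φ ψ ih ih' => exact ((ih x).sub (ih' x)).abs
  | neg φ ih => exact (ih x).const_sub 1
  | dotPlus φ ψ ih ih' => exact ((ih x).add (ih' x)).min tendsto_const_nhds
  | sup φ ih =>
    have lim := tendsto_ulim U fun i => φ.sup.eval_mem_Icc (N i) (fun j => x j i)
    have ih' := fun y => ih (Fin.cons y x)
    simp only [← cons_ultraMk, cons_apply_eq] at ih'
    convert lim using 2
    refine le_antisymm (ciSup_le fun a => ?_) (le_of_forall_pos_le_add fun ε hε => ?_)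
    · obtain ⟨y, rfl⟩ := surjective_ultraMk a
      exact le_of_tendsto_of_tendsto' (ih' y) lim fun i => φ.eval_le_eval_sup (N i) _ _
    · choose y hy using fun i => exists_lt_of_lt_ciSup
        (sub_lt_self (⨆ a : N i, φ.eval (N i) (Fin.cons a fun j => x j i)) hε)
      have h := le_of_tendsto_of_tendsto' (lim.sub_const ε) (ih' y) fun i => (hy i).le
      linarith [φ.eval_le_eval_sup (ultraproduct U N) (ultraMk y) fun j => ultraMk (x j)]
  | inf φ ih =>
    have lim := tendsto_ulim U fun i => φ.inf.eval_mem_Icc (N i) (fun j => x j i)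
    have ih' := fun y => ih (Fin.cons y x)
    simp only [← cons_ultraMk, cons_apply_eq] at ih'
    convert lim using 2
    refine le_antisymm (le_of_forall_pos_le_add fun ε hε => ?_) (le_ciInf fun a => ?_)
    · choose y hy using fun i => exists_lt_of_ciInf_lt
        (lt_add_of_pos_right (⨅ a : N i, φ.eval (N i) (Fin.cons a fun j => x j i)) hε)
      have h := le_of_tendsto_of_tendsto' (ih' y) (lim.add_const ε) fun i => (hy i).le
      exact (φ.eval_inf_le_eval (ultraproduct U N) (ultraMk y) fun j => ultraMk (x j)).trans h
    · obtain ⟨y, rfl⟩ := surjective_ultraMk a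
      exact le_of_tendsto_of_tendsto' lim (ih' y) fun i => φ.eval_inf_le_eval (N i) _ _

end Ultraproducts

/-! ### Closure properties of axiomatizable classes -/

section Necessity

variable {C : Set (MetricStructure.{u} L)}

theorem Axiomatizable.closedUnderIso (h : Axiomatizable C) : ClosedUnderIso C := by
  obtain ⟨T, hT⟩ := h
  rintro M N hM ⟨e⟩
  refine (hT N).2 fun φ hφ => ?_
  have := e.eval φ Fin.elim0
  rw [Subsingleton.elim (fun i => e.toEquiv (Fin.elim0 i)) Fin.elim0] at this
  exact this.trans ((hT M).1 hM φ hφ)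

theorem Axiomatizable.closedUnderUltraproducts (h : Axiomatizable C) :
    ClosedUnderUltraproducts C := by
  obtain ⟨T, hT⟩ := h
  intro I U N hN
  refine (hT _).2 fun φ hφ => ?_
  have lim := tendsto_eval_ultraproduct (U := U) (N := N) φ Fin.elim0
  rw [Subsingleton.elim (fun j => ultraMk (Fin.elim0 j)) Fin.elim0] at lim
  refine tendsto_nhds_unique (lim.congr fun i => ?_) tendsto_const_nhds
  exact (congrArg _ (Subsingleton.elim _ _)).trans ((hT _).1 (hN i) φ hφ)

theorem Axiomatizable.closedUnderElementarySubstructures (h : Axiomatizable C) :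
    ClosedUnderElementarySubstructures C := by
  obtain ⟨T, hT⟩ := h
  intro M hM S hS
  refine (hT _).2 fun φ hφ => (hS 0 φ _).trans ?_
  rw [Subsingleton.elim (fun i => S.incl (Fin.elim0 i)) Fin.elim0]
  exact (hT M).1 hM φ hφ

theorem AxiomatizedBy.closedUnderSubstructures (h : AxiomatizedBy C (supTheory C)) :
    ClosedUnderSubstructures C := by
  intro M hM S
  refine (h _).2 ?_
  rintro _ ⟨⟨n, φ, hφ, rfl⟩, hC⟩
  refine (satisfies_supClosure_iff _ φ).2 fun v => ?_
  rw [S.eval_of_quantifierFree hφ]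
  exact (satisfies_supClosure_iff M φ).1 (hC M hM) _

end Necessity

/-! ### Fragments of formulas -/

/-- A fragment: a set of formulas that contains `0`, `1` and the atomic formulas and is closed under
renaming of variables and under those connectives that serve to form the dyadic constants, finite
maxima, and the comparison of a formula with a constant. -/
structure Fragment (P : ∀ n, Formula L n → Prop) : Prop where
  one : ∀ {n}, P n .one
  zero : ∀ {n}, P n .zero
  pred : ∀ {n} (R : L.Pred) (t : Fin (L.predArity R) → Term L n), P n (.pred R t)
  dist : ∀ {n} (t₁ t₂ : Term L n), P n (.dist t₁ t₂)
  half : ∀ {n} {φ : Formula L n}, P n φ → P n φ.half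
  neg : ∀ {n} {φ : Formula L n}, P n φ → P n φ.neg
  dotMinus : ∀ {n} {φ ψ : Formula L n}, P n φ → P n ψ → P n (φ.dotMinus ψ)
  max : ∀ {n} {φ ψ : Formula L n}, P n φ → P n ψ → P n (φ.max ψ)
  absDiff : ∀ {n} {φ ψ : Formula L n}, P n φ → P n ψ → P n (φ.absDiff ψ)
  rename : ∀ {n m} (f : Fin n → Fin m) {φ : Formula L n}, P n φ → P m (φ.rename f)

theorem fragment_true : Fragment fun n (_ : Formula L n) => True := by
  constructor <;> intros <;> trivial

theorem fragment_quantifierFree : Fragment fun n (φ : Formula L n) => φ.QuantifierFree where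
  one := trivial
  zero := trivial
  pred _ _ := trivial
  dist _ _ := trivial
  half h := h
  neg h := h
  dotMinus h h' := ⟨h, h'⟩
  max h h' := ⟨h, h'⟩
  absDiff h h' := ⟨h, h'⟩
  rename f _ h := h.rename f

/-- The constant `2⁻ᵏ` as a formula. -/
def Formula.twoPowNeg {n : ℕ} : ℕ → Formula L n
  | 0 => .one
  | k + 1 => .half (Formula.twoPowNeg k)

theorem Formula.eval_twoPowNeg (M : MetricStructure.{u} L) {n : ℕ} (k : ℕ) (v : Fin n → M) :
    (Formula.twoPowNeg k).eval M v = (1 / 2 : ℝ) ^ k := by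
  induction k with
  | zero => simp [Formula.twoPowNeg, Formula.eval]
  | succ k ih => rw [Formula.twoPowNeg, Formula.eval, ih, pow_succ]; ring

theorem Fragment.twoPowNeg {P : ∀ n, Formula L n → Prop} (hP : Fragment P) {n : ℕ} (k : ℕ) :
    P n (Formula.twoPowNeg k) := by
  induction k with
  | zero => exact hP.one
  | succ k ih => exact hP.half ih

namespace Fragment

variable {P : ∀ n, Formula L n → Prop} {C : Set (MetricStructure.{u} L)}
  {M : MetricStructure.{u} L}

/-- The constants of a fragment are dense in `[0,1]`, uniformly in the structure. -/
theorem exists_const_near (hP : Fragment P) {n : ℕ} (k : ℕ) {r : ℝ} (hr : r ∈ Set.Icc (0 : ℝ) 1) :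
    ∃ φ : Formula L n, P n φ ∧
      ∀ (M : MetricStructure.{u} L) (v : Fin n → M), |φ.eval M v - r| ≤ (1 / 2 : ℝ) ^ k := by
  obtain ⟨h0, h1⟩ := hr
  induction k generalizing r with
  | zero =>
    refine ⟨.one, hP.one, fun M v => ?_⟩
    simp only [Formula.eval, pow_zero]
    exact abs_le.2 ⟨by linarith, by linarith⟩
  | succ k ih =>
    -- Halving a constant halves the error; `r > 1/2` is reached as `1 - (2 - 2r)/2`.
    rcases le_total r (1 / 2) with h | h
    · obtain ⟨φ, hφ, H⟩ := ih (r := 2 * r) (by linarith) (by linarith)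
      refine ⟨φ.half, hP.half hφ, fun M v => ?_⟩
      have := abs_le.1 (H M v)
      simp only [Formula.eval, pow_succ]
      exact abs_le.2 ⟨by linarith, by linarith⟩
    · obtain ⟨φ, hφ, H⟩ := ih (r := 2 - 2 * r) (by linarith) (by linarith)
      refine ⟨φ.half.neg, hP.neg (hP.half hφ), fun M v => ?_⟩
      have := abs_le.1 (H M v)
      simp only [Formula.eval, pow_succ]
      exact abs_le.2 ⟨by linarith, by linarith⟩

/-- A map that preserves the zeros of the formulas of a fragment preserves all their values. -/
theorem eval_eq_of_zero (hP : Fragment P) {K : MetricStructure.{u} L} {h : M → K}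
    (H : ∀ (n : ℕ) (φ : Formula L n), P n φ → ∀ a : Fin n → M,
      φ.eval M a = 0 → φ.eval K (h ∘ a) = 0)
    {n : ℕ} {φ : Formula L n} (hφ : P n φ) (a : Fin n → M) :
    φ.eval K (h ∘ a) = φ.eval M a := by
  refine eq_of_abs_sub_nonpos (le_of_forall_pos_le_add fun ε hε => ?_)
  obtain ⟨k, hk⟩ := exists_pow_lt_of_lt_one (half_pos hε) (by norm_num : (1 / 2 : ℝ) < 1)
  obtain ⟨c, hc, hcr⟩ := hP.exists_const_near (n := n) k (φ.eval_mem_Icc M a)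
  have hM := hcr M a
  have hK := hcr K (h ∘ a)
  -- The condition `|φ - c| ∸ 2⁻ᵏ = 0` holds at `a`, hence at its image.
  have := H n (.dotMinus (.absDiff φ c) (Formula.twoPowNeg k))
    (hP.dotMinus (hP.absDiff hφ hc) (hP.twoPowNeg k)) a
    (by
      simp only [Formula.eval, Formula.eval_twoPowNeg]
      rw [abs_sub_comm] at hM
      exact max_eq_right (by linarith))
  simp only [Formula.eval, Formula.eval_twoPowNeg, max_eq_right_iff, sub_nonpos] at this
  have h1 := abs_le.1 this
  have h2 := abs_le.1 hK
  rw [zero_add]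
  exact abs_le.2 ⟨by linarith, by linarith⟩

/-- If `M` satisfies the universal closures that hold throughout `C`, then every zero in `M` of a
formula of the fragment is approximated in members of `C`. -/
theorem exists_eval_lt (hP : Fragment P)
    (hM : ∀ (n : ℕ) (φ : Formula L n), P n φ → (∀ N ∈ C, Satisfies N φ.supClosure) →
      Satisfies M φ.supClosure)
    {n : ℕ} {φ : Formula L n} (hφ : P n φ) {a : Fin n → M} (ha : φ.eval M a = 0)
    {ε : ℝ} (hε : 0 < ε) : ∃ N ∈ C, ∃ b : Fin n → N, φ.eval N b < ε := by
  by_contra! hC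
  obtain ⟨k, hk⟩ := exists_pow_lt_of_lt_one hε (by norm_num : (1 / 2 : ℝ) < 1)
  have h := hM n (.dotMinus (Formula.twoPowNeg k) φ) (hP.dotMinus (hP.twoPowNeg k) hφ)
    fun N hN => (satisfies_supClosure_iff N _).2 fun v => by
      simp only [Formula.eval, Formula.eval_twoPowNeg]
      exact max_eq_right (by linarith [hC N hN v])
  have h' := (satisfies_supClosure_iff M _).1 h a
  simp only [Formula.eval, Formula.eval_twoPowNeg, ha, sub_zero, max_eq_right_iff] at h'
  exact absurd h' (not_le.2 (by positivity))

/-- Finitely many formulas of a fragment have an upper bound in it that vanishes wherever all of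
them do. -/
theorem exists_upper_bound (hP : Fragment P) {ι : Type*} {n : ℕ} (s : Finset ι)
    (φ : ι → Formula L n) (hφ : ∀ i ∈ s, P n (φ i)) :
    ∃ ψ : Formula L n, P n ψ ∧ ∀ (N : MetricStructure.{u} L) (v : Fin n → N),
      (∀ i ∈ s, (φ i).eval N v ≤ ψ.eval N v) ∧
        ((∀ i ∈ s, (φ i).eval N v = 0) → ψ.eval N v = 0) := by
  classical
  induction s using Finset.induction_on with
  | empty => exact ⟨.zero, hP.zero, fun N v => by simp [Formula.eval]⟩
  | insert i s _ ih =>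
    simp only [Finset.forall_mem_insert] at hφ ⊢
    obtain ⟨ψ, hψ, H⟩ := ih hφ.2
    refine ⟨.max (φ i) ψ, hP.max hφ.1 hψ, fun N v => ⟨⟨le_max_left _ _, fun j hj => ?_⟩, ?_⟩⟩
    · exact ((H N v).1 j hj).trans (le_max_right _ _)
    · rintro ⟨h0, h1⟩
      simp only [Formula.eval, h0, (H N v).2 h1, max_self]

end Fragment

/-! ### Approximate satisfiability of the diagram -/

/-- The `P`-diagram of `M`: the conditions `φ(a) = 0` with `φ` in `P` and parameters `a` from `M`
that hold in `M`. -/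
def diagram (P : ∀ n, Formula L n → Prop) (M : MetricStructure.{u} L) :
    Set (Σ n, Formula L n × (Fin n → M)) :=
  {c | P c.1 c.2.1 ∧ c.2.1.eval M c.2.2 = 0}

namespace Fragment

variable {P : ∀ n, Formula L n → Prop} {C : Set (MetricStructure.{u} L)}
  {M : MetricStructure.{u} L}

/-- The diagram of `M` is approximately finitely satisfiable in `C`, by interpretations of all the
points of `M` at once. -/
theorem exists_finset_eval_lt (hP : Fragment P)
    (hM : ∀ (n : ℕ) (φ : Formula L n), P n φ → (∀ N ∈ C, Satisfies N φ.supClosure) →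
      Satisfies M φ.supClosure)
    (s : Finset (diagram P M)) {ε : ℝ} (hε : 0 < ε) :
    ∃ N ∈ C, ∃ g : M → N, ∀ c ∈ s, c.1.2.1.eval N (g ∘ c.1.2.2) < ε := by
  classical
  let A : Finset M := s.biUnion fun c => Finset.univ.image c.1.2.2
  let e : Fin A.card → M := fun i => A.equivFin.symm i
  have he : Function.Injective e :=
    Subtype.val_injective.comp A.equivFin.symm.injective
  have hA : ∀ c ∈ s, ∀ i, ∃ j, e j = c.1.2.2 i := fun c hc i =>
    ⟨A.equivFin ⟨c.1.2.2 i, Finset.mem_biUnion.2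
      ⟨c, hc, Finset.mem_image_of_mem _ (Finset.mem_univ i)⟩⟩, by simp [e]⟩
  -- All conditions of `s` become conditions on the single injective tuple `e`.
  -- All conditions of `s` become conditions on the single injective tuple `e`.
  choose f hf using hA
  obtain ⟨ψ, hψ, H⟩ := hP.exists_upper_bound s.attach (fun c => c.1.1.2.1.rename (f c.1 c.2))
    fun c _ => hP.rename _ c.1.2.1
  have hf' : ∀ c hc, e ∘ f c hc = c.1.2.2 := fun c hc => funext (hf c hc)
  obtain ⟨N, hN, b, hb⟩ := hP.exists_eval_lt hM hψ
    ((H M e).2 fun c _ => by rw [Formula.eval_rename, hf' c.1 c.2]; exact c.1.2.2) hε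
  refine ⟨N, hN, Function.extend e b fun _ => Classical.choice N.nonempty, fun c hc => ?_⟩
  rw [← hf' c hc, ← Function.comp_assoc, Function.extend_comp he, ← Formula.eval_rename]
  exact ((H N b).1 ⟨c, hc⟩ (Finset.mem_attach _ _)).trans_lt hb

/-- If `M` satisfies the universal closures, of formulas in a fragment, that hold throughout `C`,
then `M` maps into an ultraproduct of members of `C` with all values of formulas in the fragment
preserved. -/
theorem exists_ultraproduct_map (hP : Fragment P)
    (hM : ∀ (n : ℕ) (φ : Formula L n), P n φ → (∀ N ∈ C, Satisfies N φ.supClosure) →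
      Satisfies M φ.supClosure) :
    ∃ (I : Type u) (U : Ultrafilter I) (N : I → MetricStructure.{u} L), (∀ i, N i ∈ C) ∧
      ∃ h : M → ultraproduct U N, ∀ (n : ℕ) (φ : Formula L n), P n φ → ∀ a : Fin n → M,
        φ.eval (ultraproduct U N) (h ∘ a) = φ.eval M a := by
  classical
  -- The index set consists of a finite part of the diagram and a tolerance `1/(k+1)`.
  choose N hN g hg using fun i : Finset (diagram P M) × ℕ =>
    hP.exists_finset_eval_lt hM i.1 (Nat.one_div_pos_of_nat (α := ℝ) (n := i.2))
  refine ⟨_, Ultrafilter.of atTop, N, hN, fun x => ultraMk fun i => g i x,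
    fun n φ hφ a => hP.eval_eq_of_zero (fun n φ hφ a ha => ?_) hφ a⟩
  have lim := tendsto_eval_ultraproduct (U := Ultrafilter.of atTop) φ fun j i => g i (a j)
  refine tendsto_nhds_unique lim (Tendsto.mono_left ?_ (Ultrafilter.of_le atTop))
  have h0 : Tendsto (fun i : Finset (diagram P M) × ℕ => 1 / ((i.2 : ℝ) + 1)) atTop (𝓝 0) :=
    tendsto_one_div_add_atTop_nhds_zero_nat.comp
      (prod_atTop_atTop_eq (α := Finset (diagram P M)) (β := ℕ) ▸ tendsto_snd)
  refine squeeze_zero' (Eventually.of_forall fun i => (φ.eval_mem_Icc (N i) _).1) ?_ h0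
  filter_upwards [eventually_ge_atTop (({⟨⟨n, φ, a⟩, hφ, ha⟩}, 0) :
    Finset (diagram P M) × ℕ)] with i hi
  exact (hg i _ (hi.1 (Finset.mem_singleton_self _))).le

end Fragment

/-! ### Embeddings and their images -/

/-- The inverse of an isomorphism. -/
def Iso.symm {M N : MetricStructure.{u} L} (e : Iso M N) : Iso N M where
  toEquiv := e.toEquiv.symm
  dist_eq x y := by rw [← e.dist_eq]; simp
  map_func F x := by rw [Equiv.symm_apply_eq, e.map_func]; simp
  map_pred R x := by rw [← e.map_pred]; simp

/-- A map preserving the values of the formulas of a fragment is an isomorphism onto a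
substructure. -/
theorem Fragment.exists_substructure_iso {P : ∀ n, Formula L n → Prop} (hP : Fragment P)
    {M K : MetricStructure.{u} L} (h : M → K)
    (H : ∀ (n : ℕ) (φ : Formula L n), P n φ → ∀ a : Fin n → M,
      φ.eval K (h ∘ a) = φ.eval M a) :
    ∃ (S : Substructure K) (e : Iso M S.toStructure), ∀ x, S.incl (e.toEquiv x) = h x := by
  have hd : Isometry h := Isometry.of_dist_eq fun x y =>
    H 2 (.dist (.var 0) (.var 1)) (hP.dist _ _) ![x, y]
  -- `h (F x) = F (h x)` because the formula `d(F(x_1, …, x_k), x_0)` vanishes at `(F x, x)`.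
  have hF : ∀ (F : L.Func) (x : Fin (L.funcArity F) → M),
      K.func F (fun j => h (x j)) = h (M.func F x) := by
    intro F x
    have := H _ (.dist (.app F fun j => .var j.succ) (.var 0)) (hP.dist _ _)
      (Fin.cons (M.func F x) x)
    simpa [Formula.eval, Term.eval] using this
  have hR : ∀ (R : L.Pred) (x : Fin (L.predArity R) → M),
      K.pred R (fun j => h (x j)) = M.pred R x := fun R x =>
    H _ (.pred R fun j => .var j) (hP.pred _ _) x
  let S : Substructure K :=
    { carrier := Set.range h
      nonempty' := Set.range_nonempty h
      isClosed' := hd.isClosedEmbedding.isClosed_range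
      func_mem := by
        intro F x hx
        choose y hy using hx
        exact ⟨M.func F y, by rw [← hF]; simp only [hy]⟩ }
  exact ⟨S,
    { toEquiv := Equiv.ofInjective h hd.injective
      dist_eq := hd.dist_eq
      map_func := fun F x => Subtype.ext (hF F x).symm
      map_pred := hR }, fun x => rfl⟩

end ContLogic

theorem mainTheorem10 (L : ContLogic.Signature) [Countable L.Pred] [Countable L.Func]
    (C : Set (ContLogic.MetricStructure.{u} L)) :
    (ContLogic.Axiomatizable C ↔
      ContLogic.ClosedUnderIso C ∧ ContLogic.ClosedUnderUltraproducts C ∧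
        ContLogic.ClosedUnderElementarySubstructures C) ∧
    (ContLogic.AxiomatizedBy C (ContLogic.supTheory C) ↔
      ContLogic.ClosedUnderIso C ∧ ContLogic.ClosedUnderUltraproducts C ∧
        ContLogic.ClosedUnderSubstructures C) := by
  refine ⟨⟨fun h => ⟨h.closedUnderIso, h.closedUnderUltraproducts,
    h.closedUnderElementarySubstructures⟩, ?_⟩, ⟨fun h => ⟨?_, ?_, h.closedUnderSubstructures⟩, ?_⟩⟩
  · rintro ⟨hI, hU, hS⟩
    refine ⟨{φ | ∀ N ∈ C, ContLogic.Satisfies N φ}, fun M =>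
      ⟨fun hM φ hφ => hφ M hM, fun hM => ?_⟩⟩
    obtain ⟨I, U, N, hN, h, H⟩ := ContLogic.fragment_true.exists_ultraproduct_map (C := C) (M := M)
      fun n φ _ hC => hM _ hC
    obtain ⟨S, e, he⟩ := ContLogic.fragment_true.exists_substructure_iso h H
    -- The image is elementary: both values are that of `φ` at the preimage of `a` in `M`.
    refine hI _ _ (hS _ (hU I U N hN) S fun n φ a => ?_) ⟨e.symm⟩
    rw [← e.symm.eval, ← H n φ trivial]
    congr 1
    funext i
    rw [Function.comp_apply, ← he]
    exact congrArg S.incl (e.toEquiv.apply_symm_apply _)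
  · exact ContLogic.Axiomatizable.closedUnderIso ⟨_, h⟩
  · exact ContLogic.Axiomatizable.closedUnderUltraproducts ⟨_, h⟩
  · rintro ⟨hI, hU, hS⟩ M
    refine ⟨fun hM φ hφ => hφ.2 M hM, fun hM => ?_⟩
    obtain ⟨I, U, N, hN, h, H⟩ := ContLogic.fragment_quantifierFree.exists_ultraproduct_map
      (C := C) (M := M) fun n φ hφ hC => hM _ ⟨⟨n, φ, hφ, rfl⟩, hC⟩
    obtain ⟨S, e, -⟩ := ContLogic.fragment_quantifierFree.exists_substructure_iso h H
    exact hI _ _ (hS _ (hU I U N hN) S) ⟨e.symm⟩
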